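/- **Theorem (a Hopf type lemma for anti-symmetric functions).** Let $n\ge 1$, $0<\alpha<2$, $\lambda\in\mathbb R$, let $\Sigma=\{x\in\mathbb R^n : x_1>\lambda\}$, and let $x^\lambda=(2\lambda-x_1,x_2,\dots,x_n)$ be the reflection of $x$ about the plane $\partial\Sigma=\{x_1=\lambda\}$. For a function $u$ on $\mathbb R^n$ let $$(-\Delta)^{\alpha/2}u(x)=C_{n,\alpha}\lim_{\epsilon\to0^+}\int_{\mathbb R^n\setminus B_\epsilon(x)}\frac{u(x)-u(z)}{|x-z|^{n+\alpha}}\,dz,\qquad C_{n,\alpha}=\frac{\alpha\,2^{\alpha-1}\,\Gamma(\frac{n+\alpha}{2})}{\pi^{n/2}\,\Gamma(1-\frac{\alpha}{2})},$$ which is defined at $x$ when these integrals converge absolutely and the limit exists. Let $w:\mathbb R^n\to\mathbb R$ be of class $C^3$ in a neighbourhood of every point of the closed half space $\overline\Sigma$, and let $c$ be a real function such that $$\limsup_{x\to x_0,\;x\in\Sigma}\; c(x)\,\mathrm{dist}(x,\partial\Sigma)^2\le 0\qquad\text{for every }x_0\in\partial\Sigma$$ (in particular, this holds if $c(x)=o(\mathrm{dist}(x,\partial\Sigma)^{-2})$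 near $\partial\Sigma$). Suppose that for every $x\in\Sigma$ the value $(-\Delta)^{\alpha/2}w(x)$ is defined and $$(-\Delta)^{\alpha/2}w(x)+c(x)w(x)=0,\qquad w(x)>0,\qquad w(x^\lambda)=-w(x).$$ Then $\dfrac{\partial w}{\partial\nu}(x)<0$ for every $x\in\partial\Sigma$, where $\nu=(-1,0,\dots,0)$ is the outward unit normal of $\Sigma$. -/

import Mathlib

open Filter Topology MeasureTheory

noncomputable section

/-- The open half space `{x ∈ ℝⁿ : x₁ > lam}`; the first coordinate has index `0`. -/
def halfSpace (n : ℕ) [NeZero n] (lam : ℝ) : Set (EuclideanSpace ℝ (Fin n)) :=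
  {x | lam < x 0}

/-- The reflection `(2 lam - x₁, x₂, …, xₙ)` of `x` about the plane `{x₁ = lam}`. -/
def planeReflection {n : ℕ} [NeZero n] (lam : ℝ) (x : EuclideanSpace ℝ (Fin n)) :
    EuclideanSpace ℝ (Fin n) :=
  WithLp.toLp 2 (Function.update x.ofLp 0 (2 * lam - x 0))

/-- The outward unit normal of the half space `{x₁ > lam}`, the constant vector `-e₁`. -/
def outwardNormal (n : ℕ) [NeZero n] : EuclideanSpace ℝ (Fin n) :=
  -EuclideanSpace.single 0 1

/-- The standard normalization constant `C_{n,α}` of the fractional Laplacian of order `α`,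
`α 2^(α-1) Γ((n+α)/2) / (π^(n/2) Γ(1-α/2))`, which makes its Fourier symbol `|ξ|^α`. -/
def fracLaplacianConst (n : ℕ) (α : ℝ) : ℝ :=
  α * (2 : ℝ) ^ (α - 1) * Real.Gamma ((n + α) / 2) /
    (Real.pi ^ ((n : ℝ) / 2) * Real.Gamma (1 - α / 2))

/-- `(-Δ)^(α/2) u (x)` is defined and equals `L`: the truncated integrals
`∫_{ℝⁿ \ B_ε(x)} (u(x) - u(z)) / |x - z|^(n+α) dz` converge absolutely, and `C_{n,α}` times
these integrals tends to `L` as `ε → 0⁺`. -/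
def HasFracLaplacianAt {n : ℕ} (α : ℝ) (u : EuclideanSpace ℝ (Fin n) → ℝ)
    (x : EuclideanSpace ℝ (Fin n)) (L : ℝ) : Prop :=
  (∀ ε : ℝ, 0 < ε →
    IntegrableOn (fun z => (u x - u z) / ‖x - z‖ ^ ((n : ℝ) + α)) (Metric.ball x ε)ᶜ volume) ∧
  Tendsto
    (fun ε : ℝ => fracLaplacianConst n α *
      ∫ z in (Metric.ball x ε)ᶜ, (u x - u z) / ‖x - z‖ ^ ((n : ℝ) + α))
    (𝓝[>] 0) (𝓝 L)

end

/-!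
Positivity gives `∂w/∂ν ≤ 0`, so suppose `∂w/∂ν = 0` at a boundary point and approach it along the
normal, at distance `t` from the boundary. Since `w` is odd and `C³`, it vanishes on the boundary
and its second normal derivative does too, so `w = O(t³)` along this ray. Near the singularity the
principal value only sees second differences of `w`, which by antisymmetry are halves of differences
of second differences at mirror points; these are `O(t |y|²)`, and integrating them over a ball of
small radius `r` contributes at most `o(1) t` as `r → 0`. The kernel frozen below distance `r` is a
decreasing function of the distance, so folding its integral against `w` onto the half space turns
it into one of `w > 0` against a nonnegative weight that is at least a multiple of `t` on a fixed
ball. Hence `(-Δ)^(α/2) w ≤ -k t` with `k > 0`, while `c w ≤ o(t⁻²) O(t³) = o(t)`,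
contradicting the equation.
-/

open Metric Set
open scoped NNReal fwdDiff InnerProductSpace

section Differences

variable {E F : Type*} [NormedAddCommGroup E] [NormedAddCommGroup F]

/-- The symmetric second difference `δ²_y u(x)` of a function, whose integral against `|y|^{-n-α}`
is, up to a constant, the fractional Laplacian. -/
def secondDiff (u : E → F) (x y : E) : F :=
  u (x + y) + u (x - y) - 2 • u x

theorem exists_forall_ball_of_eventually_nhds {P : E → Prop} {a : E} (h : ∀ᶠ x in 𝓝 a, P x) :
    ∃ r > 0, ∀ x ∈ ball a r, ∀ y ∈ ball (0 : E) r, P x ∧ P (x + y) ∧ P (x - y) := by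
  obtain ⟨δ, hδ, hP⟩ := Metric.eventually_nhds_iff_ball.1 h
  refine ⟨δ / 2, half_pos hδ, fun x hx y hy => ?_⟩
  rw [mem_ball_iff_norm] at hx
  rw [mem_ball_zero_iff] at hy
  refine ⟨hP x ?_, hP _ ?_, hP _ ?_⟩ <;> rw [mem_ball_iff_norm]
  · linarith
  · rw [add_sub_right_comm]
    linarith [norm_add_le (x - a) y]
  · rw [sub_right_comm]
    linarith [norm_sub_le (x - a) y]

variable [NormedSpace ℝ E] [NormedSpace ℝ F] {u : E → F} {a : E}

theorem exists_lipschitzOnWith_fwdDiff (hu : ContDiffAt ℝ 2 u a) :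
    ∃ K : ℝ≥0, ∃ r > 0, ∀ y ∈ ball (0 : E) r,
      LipschitzOnWith (K * ‖y‖₊) (Δ_[y] u) (ball a r) := by
  have hu' : ContDiffAt ℝ 1 (fderiv ℝ u) a := hu.fderiv_right (by norm_num)
  obtain ⟨K, s, hs, hK⟩ := hu'.exists_lipschitzOnWith
  have hdiff : ∀ᶠ x in 𝓝 a, x ∈ s ∧ DifferentiableAt ℝ u x :=
    (Filter.eventually_mem_set.2 hs).and
      ((hu.eventually (by simp)).mono fun x hx => hx.differentiableAt (by simp))
  obtain ⟨r, hr, hball⟩ := exists_forall_ball_of_eventually_nhds hdiff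
  refine ⟨K, r, hr, fun y hy => ?_⟩
  refine (convex_ball a r).lipschitzOnWith_of_nnnorm_hasFDerivWithin_le
    (f' := fun x => fderiv ℝ u (x + y) - fderiv ℝ u x) (fun x hx => ?_) (fun x hx => ?_)
  · obtain ⟨⟨-, hx⟩, ⟨-, hxy⟩, -⟩ := hball x hx y hy
    exact (((hasFDerivAt_comp_add_right y).2 hxy.hasFDerivAt).sub hx.hasFDerivAt).hasFDerivWithinAt
  · obtain ⟨⟨hx, -⟩, ⟨hxy, -⟩, -⟩ := hball x hx y hy
    simpa [← NNReal.coe_le_coe] using hK.norm_sub_le hxy hx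

theorem exists_norm_secondDiff_le (hu : ContDiffAt ℝ 2 u a) :
    ∃ K : ℝ≥0, ∃ r > 0, ∀ x ∈ ball a r, ∀ y ∈ ball (0 : E) r,
      ‖secondDiff u x y‖ ≤ K * ‖y‖ ^ 2 := by
  obtain ⟨K, δ, hδ, hK⟩ := exists_lipschitzOnWith_fwdDiff hu
  obtain ⟨r, hr, hball⟩ := exists_forall_ball_of_eventually_nhds (ball_mem_nhds a hδ)
  refine ⟨K, min r δ, lt_min hr hδ, fun x hx y hy => ?_⟩
  obtain ⟨hx, -, hxy⟩ :=
    hball x (ball_subset_ball (min_le_left r δ) hx) y (ball_subset_ball (min_le_left r δ) hy)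
  have hfwd : secondDiff u x y = Δ_[y] u x - Δ_[y] u (x - y) := by
    simp only [secondDiff, fwdDiff, sub_add_cancel]
    abel
  calc ‖secondDiff u x y‖ = ‖Δ_[y] u x - Δ_[y] u (x - y)‖ := by rw [hfwd]
    _ ≤ K * ‖y‖ * ‖x - (x - y)‖ :=
      (hK y (ball_subset_ball (min_le_right r δ) hy)).norm_sub_le hx hxy
    _ = K * ‖y‖ ^ 2 := by rw [sub_sub_cancel]; ring

theorem exists_lipschitzOnWith_secondDiff (hu : ContDiffAt ℝ 3 u a) :
    ∃ K : ℝ≥0, ∃ r > 0, ∀ y ∈ ball (0 : E) r,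
      LipschitzOnWith (K * ‖y‖₊ ^ 2) (fun x => secondDiff u x y) (ball a r) := by
  obtain ⟨K, δ, hδ, hK⟩ := exists_norm_secondDiff_le (hu.fderiv_right (m := 2) (by norm_num))
  obtain ⟨r, hr, hdiff⟩ := exists_forall_ball_of_eventually_nhds
    ((hu.eventually (by simp)).mono fun x hx => hx.differentiableAt (by simp))
  refine ⟨K, min r δ, lt_min hr hδ, fun y hy => ?_⟩
  refine (convex_ball a _).lipschitzOnWith_of_nnnorm_hasFDerivWithin_le
    (f' := fun x => secondDiff (fderiv ℝ u) x y) (fun x hx => ?_) (fun x hx => ?_)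
  · obtain ⟨h, hadd, hsub⟩ :=
      hdiff x (ball_subset_ball (min_le_left r δ) hx) y (ball_subset_ball (min_le_left r δ) hy)
    exact ((((hasFDerivAt_comp_add_right y).2 hadd.hasFDerivAt).add
      ((hasFDerivAt_comp_sub y).2 hsub.hasFDerivAt)).sub
        (h.hasFDerivAt.const_smul 2)).hasFDerivWithinAt
  · exact hK x (ball_subset_ball (min_le_right r δ) hx) y
      (ball_subset_ball (min_le_right r δ) hy)

theorem exists_norm_centralDiff_sub_fderiv_le (hu : ContDiffAt ℝ 3 u a) :
    ∃ K : ℝ≥0, ∃ r > 0, ∀ y ∈ ball (0 : E) r,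
      ‖u (a + y) - u (a - y) - 2 • fderiv ℝ u a y‖ ≤ K * ‖y‖ ^ 3 := by
  obtain ⟨K, δ, hδ, hK⟩ := exists_norm_secondDiff_le (hu.fderiv_right (m := 2) (by norm_num))
  obtain ⟨r, hr, hdiff⟩ := exists_forall_ball_of_eventually_nhds
    ((hu.eventually (by simp)).mono fun x hx => hx.differentiableAt (by simp))
  refine ⟨K, min r δ, lt_min hr hδ, fun y hy => ?_⟩
  have hball : ∀ z ∈ closedBall (0 : E) ‖y‖, z ∈ ball (0 : E) (min r δ) := fun z hz =>
    closedBall_subset_ball (mem_ball_zero_iff.1 hy) hz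
  have hderiv : ∀ z ∈ closedBall (0 : E) ‖y‖, HasFDerivWithinAt
      (fun z => u (a + z) - u (a - z) - 2 • fderiv ℝ u a z) (secondDiff (fderiv ℝ u) a z)
      (closedBall 0 ‖y‖) z := fun z hz => by
    obtain ⟨-, hadd, hsub⟩ := hdiff a (mem_ball_self hr) z
      (ball_subset_ball (min_le_left r δ) (hball z hz))
    have hsub' := hsub.hasFDerivAt.comp z ((hasFDerivAt_id z).const_sub a)
    refine (((((hasFDerivAt_comp_add_left a).2 hadd.hasFDerivAt).sub hsub').sub
      ((fderiv ℝ u a).hasFDerivAt.const_smul 2)).congr_fderiv ?_).hasFDerivWithinAt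
    ext v
    simp [secondDiff]
  have hbound : ∀ z ∈ closedBall (0 : E) ‖y‖, ‖secondDiff (fderiv ℝ u) a z‖ ≤ K * ‖y‖ ^ 2 :=
    fun z hz => (hK a (mem_ball_self hδ) z (ball_subset_ball (min_le_right r δ) (hball z hz))).trans
      (by gcongr; exact mem_closedBall_zero_iff.1 hz)
  have hmv := (convex_closedBall (0 : E) ‖y‖).norm_image_sub_le_of_norm_hasFDerivWithin_le
    hderiv hbound (mem_closedBall_self (norm_nonneg y)) (mem_closedBall_zero_iff.2 le_rfl)
  calc ‖u (a + y) - u (a - y) - 2 • fderiv ℝ u a y‖ ≤ K * ‖y‖ ^ 2 * ‖y‖ := by simpa using hmv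
    _ = K * ‖y‖ ^ 3 := by ring

end Differences

section Reflection

variable {E : Type*} [NormedAddCommGroup E] [InnerProductSpace ℝ E]

theorem reflection_orthogonal_singleton_smul (e : E) (t : ℝ) :
    (ℝ ∙ e)ᗮ.reflection (t • e) = -(t • e) := by
  rw [map_smul, Submodule.reflection_orthogonalComplement_singleton_eq_neg, smul_neg]

theorem inner_reflection_orthogonal_singleton (e y : E) :
    ⟪e, (ℝ ∙ e)ᗮ.reflection y⟫_ℝ = -⟪e, y⟫_ℝ := by
  rw [← (ℝ ∙ e)ᗮ.reflection.inner_map_map, Submodule.reflection_reflection,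
    Submodule.reflection_orthogonalComplement_singleton_eq_neg, inner_neg_left]

theorem norm_sub_reflection_sq_sub (e : E) (t : ℝ) (z : E) :
    ‖z - (ℝ ∙ e)ᗮ.reflection (t • e)‖ ^ 2 - ‖z - t • e‖ ^ 2 = 4 * t * ⟪e, z⟫_ℝ := by
  rw [reflection_orthogonal_singleton_smul, sub_neg_eq_add, norm_add_sq_real, norm_sub_sq_real,
    inner_smul_right, real_inner_comm]
  ring

/-- Antisymmetry of a function under the orthogonal reflection in a subspace, which is a
hyperplane `e^⊥` in the application. -/
def OddAcross (K : Submodule ℝ E) [K.HasOrthogonalProjection] (u : E → ℝ) : Prop :=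
  ∀ y, u (K.reflection y) = -u y

namespace OddAcross

variable {K : Submodule ℝ E} [K.HasOrthogonalProjection] {u : E → ℝ} {e : E}

theorem eq_zero_of_mem (hu : OddAcross K u) {y : E} (hy : y ∈ K) : u y = 0 := by
  have h := hu y
  rw [Submodule.reflection_mem_subspace_eq_self hy] at h
  linarith

theorem apply_neg_smul (hu : OddAcross (ℝ ∙ e)ᗮ u) (t : ℝ) : u (-(t • e)) = -u (t • e) := by
  rw [← hu, reflection_orthogonal_singleton_smul]

theorem nonneg_of_inner_nonneg (hu : OddAcross (ℝ ∙ e)ᗮ u)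
    (hpos : ∀ y, 0 < ⟪e, y⟫_ℝ → 0 < u y) {y : E} (hy : 0 ≤ ⟪e, y⟫_ℝ) : 0 ≤ u y := by
  rcases hy.eq_or_lt with hy | hy
  · exact (hu.eq_zero_of_mem (Submodule.mem_orthogonal_singleton_iff_inner_right.2 hy.symm)).ge
  · exact (hpos y hy).le

theorem nonpos_of_inner_nonpos (hu : OddAcross (ℝ ∙ e)ᗮ u)
    (hpos : ∀ y, 0 < ⟪e, y⟫_ℝ → 0 < u y) {y : E} (hy : ⟪e, y⟫_ℝ ≤ 0) : u y ≤ 0 := by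
  have h := hu.nonneg_of_inner_nonneg hpos (y := (ℝ ∙ e)ᗮ.reflection y)
    (by rwa [inner_reflection_orthogonal_singleton, neg_nonneg])
  rwa [hu y, neg_nonneg] at h

theorem fderiv_nonneg (hu : OddAcross (ℝ ∙ e)ᗮ u) (hpos : ∀ y, 0 < ⟪e, y⟫_ℝ → 0 < u y)
    (hdiff : DifferentiableAt ℝ u 0) : 0 ≤ fderiv ℝ u 0 e := by
  have hmin : IsMinOn u {y | 0 ≤ ⟪e, y⟫_ℝ} 0 := fun y hy => by
    rw [mem_ofPred_eq, hu.eq_zero_of_mem (zero_mem _)]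
    exact hu.nonneg_of_inner_nonneg hpos hy
  refine hmin.localize.hasFDerivWithinAt_nonneg hdiff.hasFDerivAt.hasFDerivWithinAt
    (mem_posTangentConeAt_of_segment_subset fun y hy => ?_)
  obtain ⟨t, ht, rfl⟩ := (mem_segment_iff_wbtw.1 hy)
  simpa [AffineMap.lineMap_apply, inner_smul_right] using mul_nonneg ht.1 (sq_nonneg ‖e‖)

variable {a : E} {k : ℝ → ℝ}

theorem mul_norm_reflection_sub (hu : OddAcross K u) (z : E) :
    u (K.reflection z) * k ‖K.reflection z - a‖ = -(u z * k ‖z - K.reflection a‖) := by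
  rw [hu, ← K.reflection.norm_map (z - _), map_sub, Submodule.reflection_reflection, neg_mul]

variable [FiniteDimensional ℝ E] [MeasurableSpace E] [BorelSpace E]

/-- The integrand is averaged over the group generated by `y ↦ -y` and the reflection, both of
which preserve radial kernels. -/
theorem four_mul_integral_sub_mul_norm (hu : OddAcross K u)
    (hint : Integrable fun y => (u a - u (a + y)) * k ‖y‖) :
    4 * ∫ y, (u a - u (a + y)) * k ‖y‖ =
      ∫ y, (secondDiff u (K.reflection a) y - secondDiff u a y) * k ‖y‖ := by
  set F : E → ℝ := fun y => (u a - u (a + y)) * k ‖y‖ with hF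
  have hR : MeasurePreserving K.reflection (volume : Measure E) volume :=
    K.reflection.measurePreserving
  have hRe : MeasurableEmbedding K.reflection := K.reflection.toHomeomorph.measurableEmbedding
  have hevenint : Integrable fun y => F y + F (-y) := hint.add hint.comp_neg
  have heven : ∫ y, (F y + F (-y)) = 2 * ∫ y, F y := by
    rw [integral_add hint hint.comp_neg, integral_neg_eq_self F volume, two_mul]
  have hrefl (y : E) : u (a + K.reflection y) = -u (K.reflection a + y) := by
    rw [← hu, map_add, Submodule.reflection_reflection]
  calc 4 * ∫ y, F y
      = (∫ y, (F y + F (-y))) + ∫ y, (F (K.reflection y) + F (-K.reflection y)) := by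
        rw [hR.integral_comp hRe fun y => F y + F (-y), heven]
        ring
    _ = ∫ y, ((F y + F (-y)) + (F (K.reflection y) + F (-K.reflection y))) :=
        (integral_add hevenint ((hR.integrable_comp_emb hRe).2 hevenint)).symm
    _ = _ := integral_congr_ae (ae_of_all _ fun y => by
        simp only [hF, secondDiff, ← map_neg, LinearIsometryEquiv.norm_map, norm_neg, hrefl, hu a,
          ← sub_eq_add_neg, two_nsmul]
        ring)

theorem integrable_mul_norm_sub_reflection (hu : OddAcross K u)
    (hint : Integrable fun z => u z * k ‖z - a‖) :
    Integrable fun z => u z * k ‖z - K.reflection a‖ := by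
  simpa only [Function.comp_def, hu.mul_norm_reflection_sub, neg_neg] using
    ((K.reflection.measurePreserving.integrable_comp_emb
      K.reflection.toHomeomorph.measurableEmbedding).2 hint).fun_neg

theorem integral_mul_norm_sub_reflection (hu : OddAcross K u) :
    ∫ z, u z * k ‖z - K.reflection a‖ = -∫ z, u z * k ‖z - a‖ := by
  rw [← K.reflection.measurePreserving.integral_comp
    K.reflection.toHomeomorph.measurableEmbedding fun z => u z * k ‖z - a‖]
  simp only [hu.mul_norm_reflection_sub, integral_neg, neg_neg]

theorem two_mul_integral_mul_norm_sub (hu : OddAcross K u)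
    (hint : Integrable fun z => u z * k ‖z - a‖) :
    2 * ∫ z, u z * k ‖z - a‖ = ∫ z, u z * (k ‖z - a‖ - k ‖z - K.reflection a‖) := by
  simp only [mul_sub]
  rw [integral_sub hint (hu.integrable_mul_norm_sub_reflection hint),
    hu.integral_mul_norm_sub_reflection]
  ring

end OddAcross

end Reflection

section TruncatedPower

variable {p r s : ℝ}

/-- The power `s ^ (-p)`, frozen at its value `r ^ (-p)` for `s ≤ r`. Composed with the norm it is
an integrable replacement for the singular kernel of the fractional Laplacian. -/
noncomputable def truncRpow (p r s : ℝ) : ℝ :=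
  max s r ^ (-p)

theorem truncRpow_nonneg (hr : 0 ≤ r) (s : ℝ) : 0 ≤ truncRpow p r s :=
  Real.rpow_nonneg (hr.trans (le_max_right s r)) _

theorem truncRpow_of_le (h : r ≤ s) : truncRpow p r s = s ^ (-p) := by
  rw [truncRpow, max_eq_left h]

theorem truncRpow_le_rpow_neg (hp : 0 ≤ p) (hs : 0 < s) : truncRpow p r s ≤ s ^ (-p) :=
  Real.rpow_le_rpow_of_nonpos hs (le_max_left s r) (neg_nonpos.2 hp)

theorem abs_rpow_neg_sub_truncRpow_le (hp : 0 ≤ p) (hr : 0 ≤ r) (hs : 0 < s) :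
    |s ^ (-p) - truncRpow p r s| ≤ s ^ (-p) := by
  rw [abs_of_nonneg (sub_nonneg.2 (truncRpow_le_rpow_neg hp hs))]
  exact sub_le_self _ (truncRpow_nonneg hr s)

theorem antitone_truncRpow (hp : 0 ≤ p) (hr : 0 < r) : Antitone (truncRpow p r) := fun _ _ h =>
  Real.rpow_le_rpow_of_nonpos (hr.trans_le (le_max_right _ r)) (max_le_max_right r h)
    (neg_nonpos.2 hp)

theorem continuous_truncRpow (hr : 0 < r) : Continuous (truncRpow p r) :=
  (continuous_id.max continuous_const).rpow_const fun s =>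
    Or.inl (hr.trans_le (le_max_right s r)).ne'

theorem truncRpow_le_one_add_rpow_neg (hp : 0 ≤ p) (hr : 0 < r) (hs : 0 ≤ s) :
    truncRpow p r s ≤ (1 + r⁻¹) ^ p * (1 + s) ^ (-p) := by
  have hmax : (1 + s) / (1 + r⁻¹) ≤ max s r := by
    have h : 1 ≤ max s r * r⁻¹ := by
      rw [← div_eq_mul_inv, one_le_div hr]
      exact le_max_right s r
    rw [div_le_iff₀ (by positivity)]
    linarith [le_max_left s r]
  calc truncRpow p r s ≤ ((1 + s) / (1 + r⁻¹)) ^ (-p) :=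
        Real.rpow_le_rpow_of_nonpos (by positivity) hmax (neg_nonpos.2 hp)
    _ = (1 + r⁻¹) ^ p * (1 + s) ^ (-p) := by
        rw [Real.div_rpow (by positivity) (by positivity), Real.rpow_neg (x := 1 + r⁻¹)
          (by positivity), div_inv_eq_mul, mul_comm]

theorem mul_rpow_sub_le_rpow_neg_sub_rpow_neg (hp : 0 ≤ p) (hr : 0 < r) (hrs : r ≤ s) :
    p * s ^ (-p - 1) * (s - r) ≤ r ^ (-p) - s ^ (-p) := by
  have hderiv : ∀ x ∈ Icc r s, HasDerivAt (fun x : ℝ => -x ^ (-p)) (p * x ^ (-p - 1)) x :=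
    fun x hx => by
      simpa using (Real.hasDerivAt_rpow_const (p := -p) (Or.inl (hr.trans_le hx.1).ne')).fun_neg
  have h := (convex_Icc r s).mul_sub_le_image_sub_of_le_deriv (C := p * s ^ (-p - 1))
    (fun x hx => (hderiv x hx).continuousAt.continuousWithinAt)
    (fun x hx => (hderiv x (interior_subset hx)).differentiableAt.differentiableWithinAt)
    (fun x hx => by
      rw [(hderiv x (interior_subset hx)).deriv]
      have hx := interior_subset hx
      exact mul_le_mul_of_nonneg_left
        (Real.rpow_le_rpow_of_nonpos (hr.trans_le hx.1) hx.2 (by linarith)) hp)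
    r (left_mem_Icc.2 hrs) s (right_mem_Icc.2 hrs) hrs
  linarith

variable {E : Type*} [NormedAddCommGroup E] [InnerProductSpace ℝ E] [FiniteDimensional ℝ E]
  [MeasurableSpace E] [BorelSpace E]

theorem integrable_truncRpow_norm (hp : (Module.finrank ℝ E : ℝ) < p) (hr : 0 < r) :
    Integrable fun y : E => truncRpow p r ‖y‖ := by
  refine ((integrable_one_add_norm (μ := volume) hp).const_mul ((1 + r⁻¹) ^ p)).mono'
    ((continuous_truncRpow hr).comp continuous_norm).aestronglyMeasurable
    (ae_of_all _ fun y => ?_)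
  rw [Real.norm_of_nonneg (truncRpow_nonneg hr.le _)]
  exact truncRpow_le_one_add_rpow_neg ((Nat.cast_nonneg _).trans hp.le) hr (norm_nonneg y)

end TruncatedPower

section BallIntegrals

theorem tendsto_measure_ball_nhdsGT_zero {X : Type*} [MetricSpace X] [ProperSpace X]
    [MeasurableSpace X] [OpensMeasurableSpace X] (μ : Measure X) [IsFiniteMeasureOnCompacts μ]
    [NullSingletonClass μ] (x : X) : Tendsto (fun r => μ (ball x r)) (𝓝[>] 0) (𝓝 0) := by
  have h := tendsto_measure_biInter_gt (μ := μ) (s := ball x) (a := (0 : ℝ))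
    (fun r _ => measurableSet_ball.nullMeasurableSet) (fun i j _ hij => ball_subset_ball hij)
    ⟨1, one_pos, measure_ball_lt_top.ne⟩
  rwa [Metric.biInter_gt_ball, closedBall_zero, measure_singleton] at h

variable {E : Type*} [NormedAddCommGroup E] [InnerProductSpace ℝ E] [FiniteDimensional ℝ E]
  [Nontrivial E] [MeasurableSpace E] [BorelSpace E] {q : ℝ}

theorem integrableOn_ball_norm_rpow (hq : -(Module.finrank ℝ E : ℝ) < q) (r : ℝ) :
    IntegrableOn (fun y : E => ‖y‖ ^ q) (ball 0 r) := by
  refine integrableOn_ball_of_norm_le_rpow Module.finrank_pos (C := 1) (α := -q) (by linarith)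
    (ae_of_all _ fun y => ?_) (measurable_norm.pow_const _).aestronglyMeasurable
  rw [Real.norm_of_nonneg (Real.rpow_nonneg (norm_nonneg y) q), one_mul, neg_neg]

theorem tendsto_integral_ball_norm_rpow (hq : -(Module.finrank ℝ E : ℝ) < q) :
    Tendsto (fun r => ∫ y in ball (0 : E) r, ‖y‖ ^ q) (𝓝[>] 0) (𝓝 0) := by
  have h : Integrable ((ball (0 : E) 1).indicator fun y => ‖y‖ ^ q) :=
    (integrable_indicator_iff measurableSet_ball).2 (integrableOn_ball_norm_rpow hq 1)
  refine (h.tendsto_setIntegral_nhds_zero (tendsto_measure_ball_nhdsGT_zero volume 0)).congr' ?_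
  filter_upwards [nhdsWithin_le_nhds (Iio_mem_nhds one_pos)] with r hr
  exact setIntegral_congr_fun measurableSet_ball fun y hy =>
    indicator_of_mem (ball_subset_ball (le_of_lt hr) hy) _

end BallIntegrals

section PrincipalValue

variable {E : Type*} [NormedAddCommGroup E] [InnerProductSpace ℝ E] [FiniteDimensional ℝ E]
  [MeasurableSpace E] [BorelSpace E] {p : ℝ} {u : E → ℝ} {a : E} {ℓ : ℝ}

/-- `ℓ` is the principal value of the absolutely convergent truncations of
`∫ (u a - u (a + y)) ‖y‖ ^ (-p) dy`, that is, the value at `a` of the fractional Laplacian of order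
`p - dim E` without its normalizing constant. -/
def HasPrincipalValueAt (p : ℝ) (u : E → ℝ) (a : E) (ℓ : ℝ) : Prop :=
  (∀ ε > 0, IntegrableOn (fun y => (u a - u (a + y)) * ‖y‖ ^ (-p)) (ball 0 ε)ᶜ) ∧
    Tendsto (fun ε => ∫ y in (ball 0 ε)ᶜ, (u a - u (a + y)) * ‖y‖ ^ (-p)) (𝓝[>] 0) (𝓝 ℓ)

theorem eventually_integrableAtFilter_nhds (h : ∀ᶠ x in 𝓝 a, ContinuousAt u x) :
    ∀ᶠ x in 𝓝 a, IntegrableAtFilter u (𝓝 x) := by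
  obtain ⟨s, hs, hsu, hcompact⟩ := local_compact_nhds h
  have hint : IntegrableOn u s :=
    ContinuousOn.integrableOn_compact hcompact fun x hx => (hsu hx).continuousWithinAt
  exact (eventually_mem_nhds_iff.2 hs).mono fun x hx => ⟨s, hx, hint⟩

theorem integrableOn_compl_ball_add_left_iff {f : E → ℝ} {ε : ℝ} :
    IntegrableOn (fun y => f (a + y)) (ball 0 ε)ᶜ ↔ IntegrableOn f (ball a ε)ᶜ := by
  rw [← (measurePreserving_add_left volume a).integrableOn_comp_preimage
    (measurableEmbedding_addLeft a) (s := (ball a ε)ᶜ), preimage_compl, preimage_add_ball, sub_self]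
  rfl

namespace HasPrincipalValueAt

theorem locallyIntegrable (h : HasPrincipalValueAt p u a ℓ)
    (hloc : IntegrableAtFilter u (𝓝 a)) : LocallyIntegrable u := fun x => by
  rcases eq_or_ne x a with rfl | hx
  · exact hloc
  set δ := dist x a / 2 with hδ
  have hpos : 0 < δ := half_pos (dist_pos.2 hx)
  have hfar : closedBall x δ ⊆ (ball a δ)ᶜ := fun z hz hza => by
    linarith [dist_triangle_left x a z, mem_closedBall.1 hz, mem_ball.1 hza]
  have hquot : IntegrableOn (fun z => (u a - u z) * ‖z - a‖ ^ (-p)) (closedBall x δ) :=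
    (integrableOn_compl_ball_add_left_iff.1
      (by simpa only [add_sub_cancel_left] using h.1 δ hpos)).mono_set hfar
  have hne : ∀ z ∈ closedBall x δ, 0 < ‖z - a‖ := fun z hz => by
    rw [← dist_eq_norm]
    exact hpos.trans_le (not_lt.1 (hfar hz))
  have hcont : ContinuousOn (fun z => ‖z - a‖ ^ p) (closedBall x δ) := fun z hz =>
    ((by fun_prop : ContinuousAt (fun z => ‖z - a‖) z).rpow_const
      (Or.inl (hne z hz).ne')).continuousWithinAt
  refine ⟨closedBall x δ, closedBall_mem_nhds x hpos,
    ((integrableOn_const (C := u a) (isCompact_closedBall x δ).measure_ne_top).fun_sub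
      (hquot.mul_continuousOn hcont (isCompact_closedBall x δ))).congr_fun (fun z hz => ?_)
      measurableSet_closedBall⟩
  beta_reduce
  rw [mul_assoc, ← Real.rpow_add (hne z hz), neg_add_cancel, Real.rpow_zero]
  ring

theorem integrable_mul_truncRpow {r : ℝ} (h : HasPrincipalValueAt p u a ℓ)
    (hloc : LocallyIntegrable u) (hr : 0 < r) :
    Integrable fun y => (u a - u (a + y)) * truncRpow p r ‖y‖ := by
  rw [← integrableOn_univ, ← union_compl_self (ball (0 : E) r)]
  refine IntegrableOn.union ?_ ((h.1 r hr).congr_fun (fun y hy => ?_) measurableSet_ball.compl)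
  · have hshift := ((measurePreserving_add_left volume a).integrableOn_comp_preimage
      (measurableEmbedding_addLeft a)).2 (hloc.integrableOn_isCompact (isCompact_closedBall a r))
    rw [preimage_add_closedBall, sub_self] at hshift
    have hcompact := isCompact_closedBall (0 : E) r
    exact (((integrableOn_const hcompact.measure_ne_top).sub hshift).mul_continuousOn
      ((continuous_truncRpow hr).comp continuous_norm).continuousOn hcompact).mono_set
        ball_subset_closedBall
  · rw [mem_compl_iff, mem_ball_zero_iff, not_lt] at hy
    simp only [truncRpow_of_le hy]

end HasPrincipalValueAt

theorem OddAcross.setIntegral_sub_mul_le {K : Submodule ℝ E} {r C ε : ℝ} (hu : OddAcross K u)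
    (hp : 0 ≤ p) (hr : 0 < r) (hε : 0 < ε) (hC : 0 ≤ C)
    (hdiff : ∀ y ∈ ball (0 : E) r,
      |secondDiff u (K.reflection a) y - secondDiff u a y| ≤ C * ‖y‖ ^ 2)
    (hrad : IntegrableOn (fun y : E => ‖y‖ ^ (2 - p)) (ball 0 r))
    (hint : IntegrableOn (fun y => (u a - u (a + y)) * (‖y‖ ^ (-p) - truncRpow p r ‖y‖))
      (ball 0 ε)ᶜ) :
    ∫ y in (ball 0 ε)ᶜ, (u a - u (a + y)) * (‖y‖ ^ (-p) - truncRpow p r ‖y‖) ≤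
      C / 4 * ∫ y in ball (0 : E) r, ‖y‖ ^ (2 - p) := by
  set k : ℝ → ℝ := (Ici ε).indicator fun s => s ^ (-p) - truncRpow p r s with hk
  have hindicator : (ball 0 ε)ᶜ.indicator
      (fun y => (u a - u (a + y)) * (‖y‖ ^ (-p) - truncRpow p r ‖y‖)) =
      fun y => (u a - u (a + y)) * k ‖y‖ := by
    ext y
    by_cases hy : ε ≤ ‖y‖ <;> simp [hk, hy]
  rw [← integrable_indicator_iff measurableSet_ball.compl, hindicator] at hint
  have hbound (y : E) : ‖(secondDiff u (K.reflection a) y - secondDiff u a y) * k ‖y‖‖ ≤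
      (ball 0 r).indicator (fun y => C * ‖y‖ ^ (2 - p)) y := by
    rcases lt_or_ge ‖y‖ ε with hyε | hyε
    · rw [hk, indicator_of_notMem (notMem_Ici.2 hyε), mul_zero, norm_zero]
      exact indicator_nonneg (fun y _ => by positivity) y
    rw [hk, indicator_of_mem (mem_Ici.2 hyε)]
    rcases lt_or_ge ‖y‖ r with hyr | hyr
    · have hy : 0 < ‖y‖ := hε.trans_le hyε
      rw [indicator_of_mem (mem_ball_zero_iff.2 hyr), norm_mul, sub_eq_add_neg 2 p,
        Real.rpow_add hy, Real.rpow_two, ← mul_assoc]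
      exact mul_le_mul (hdiff y (mem_ball_zero_iff.2 hyr))
        (abs_rpow_neg_sub_truncRpow_le hp hr.le hy) (norm_nonneg _) (by positivity)
    · rw [truncRpow_of_le hyr, sub_self, mul_zero, norm_zero]
      exact indicator_nonneg (fun y _ => by positivity) y
  have hfour := hu.four_mul_integral_sub_mul_norm hint
  have hle := (le_abs_self _).trans (norm_integral_le_of_norm_le
    ((integrable_indicator_iff measurableSet_ball).2 (hrad.const_mul C)) (ae_of_all _ hbound))
  rw [integral_indicator measurableSet_ball, integral_const_mul] at hle
  rw [← integral_indicator measurableSet_ball.compl, hindicator]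
  linarith

variable [Nontrivial E]

/-- Near the singularity only the symmetrized second differences contribute to the principal value;
elsewhere the kernel may be truncated. -/
theorem HasPrincipalValueAt.le_of_oddAcross {K : Submodule ℝ E} {r C : ℝ}
    (h : HasPrincipalValueAt p u a ℓ) (hu : OddAcross K u) (hloc : LocallyIntegrable u)
    (hp : 0 ≤ p) (hr : 0 < r) (hC : 0 ≤ C)
    (hdiff : ∀ y ∈ ball (0 : E) r,
      |secondDiff u (K.reflection a) y - secondDiff u a y| ≤ C * ‖y‖ ^ 2)
    (hrad : IntegrableOn (fun y : E => ‖y‖ ^ (2 - p)) (ball 0 r)) :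
    ℓ ≤ C / 4 * (∫ y in ball (0 : E) r, ‖y‖ ^ (2 - p)) +
      ∫ y, (u a - u (a + y)) * truncRpow p r ‖y‖ := by
  have htrunc := h.integrable_mul_truncRpow hloc hr
  have hball := htrunc.tendsto_setIntegral_nhds_zero
    (tendsto_measure_ball_nhdsGT_zero (volume : Measure E) 0)
  have hlim := tendsto_const_nhds (x := C / 4 * ∫ y in ball (0 : E) r, ‖y‖ ^ (2 - p)) |>.add
    (tendsto_const_nhds (x := ∫ y, (u a - u (a + y)) * truncRpow p r ‖y‖) |>.sub hball)
  rw [sub_zero] at hlim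
  refine le_of_tendsto_of_tendsto h.2 hlim (eventually_mem_nhdsWithin.mono fun ε hε => ?_)
  have hint : IntegrableOn (fun y => (u a - u (a + y)) * (‖y‖ ^ (-p) - truncRpow p r ‖y‖))
      (ball 0 ε)ᶜ := by
    simpa only [mul_sub] using (h.1 ε hε).fun_sub htrunc.integrableOn
  calc ∫ y in (ball 0 ε)ᶜ, (u a - u (a + y)) * ‖y‖ ^ (-p)
      = (∫ y in (ball 0 ε)ᶜ, (u a - u (a + y)) * (‖y‖ ^ (-p) - truncRpow p r ‖y‖)) +
          ∫ y in (ball 0 ε)ᶜ, (u a - u (a + y)) * truncRpow p r ‖y‖ := by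
        rw [← integral_add hint htrunc.integrableOn]
        simp only [← mul_add, sub_add_cancel]
    _ ≤ _ := add_le_add (hu.setIntegral_sub_mul_le hp hr hε hC hdiff hrad hint)
        (setIntegral_compl measurableSet_ball htrunc).le

end PrincipalValue

section BoundaryAsymptotics

variable {E : Type*} [NormedAddCommGroup E] [InnerProductSpace ℝ E] {p r t : ℝ} {u : E → ℝ} {e : E}

theorem one_le_inner_of_mem_ball (he : ‖e‖ = 1) {z : E} (hz : z ∈ ball ((2 : ℝ) • e) 1) :
    1 ≤ ⟪e, z⟫_ℝ := by
  have h : |⟪e, z - (2 : ℝ) • e⟫_ℝ| ≤ ‖z - (2 : ℝ) • e‖ := by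
    simpa [he] using abs_real_inner_le_norm e (z - (2 : ℝ) • e)
  rw [inner_sub_right, inner_smul_right, real_inner_self_eq_norm_sq, he] at h
  linarith [(abs_le.1 h).1, mem_ball_iff_norm.1 hz]

theorem mul_le_truncRpow_norm_sub (he : ‖e‖ = 1) (hp : 0 ≤ p) (hr : r ≤ 1 / 2) (ht : 0 ≤ t)
    (ht' : t ≤ 1 / 2) {z : E} (hz : z ∈ ball ((2 : ℝ) • e) 1) :
    p * 4 ^ (-p - 1) * (t / 2) ≤
      truncRpow p r ‖z - t • e‖ - truncRpow p r ‖z - (ℝ ∙ e)ᗮ.reflection (t • e)‖ := by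
  have hinner := one_le_inner_of_mem_ball he hz
  have hsq := norm_sub_reflection_sq_sub e t z
  set a := ‖z - t • e‖
  set b := ‖z - (ℝ ∙ e)ᗮ.reflection (t • e)‖ with hb
  have ha_ge : 1 / 2 ≤ a := by
    have h := (le_abs_self _).trans (abs_real_inner_le_norm e (z - t • e))
    rw [inner_sub_right, inner_smul_right, real_inner_self_eq_norm_sq, he] at h
    linarith
  have hb_le : b ≤ 4 := by
    have h := norm_add_le (z - (2 : ℝ) • e) ((2 + t) • e)
    rw [norm_smul, he, Real.norm_of_nonneg (by linarith), add_smul, ← add_assoc,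
      sub_add_cancel] at h
    rw [hb, reflection_orthogonal_singleton_smul, sub_neg_eq_add]
    linarith [mem_ball_iff_norm.1 hz]
  have hab : a ≤ b := le_of_sq_le_sq (by nlinarith) (norm_nonneg _)
  have hgap : t / 2 ≤ b - a := by nlinarith
  rw [truncRpow_of_le (hr.trans ha_ge), truncRpow_of_le (hr.trans (ha_ge.trans hab))]
  calc p * 4 ^ (-p - 1) * (t / 2) ≤ p * b ^ (-p - 1) * (b - a) := by
        gcongr ?_ * ?_
        exact mul_le_mul_of_nonneg_left
          (Real.rpow_le_rpow_of_nonpos (by linarith) hb_le (by linarith)) hp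
    _ ≤ a ^ (-p) - b ^ (-p) := mul_rpow_sub_le_rpow_neg_sub_rpow_neg hp (by linarith) hab

theorem exists_abs_secondDiff_reflection_sub_le (he : ‖e‖ = 1) (hsm : ContDiffAt ℝ 3 u 0) :
    ∃ C ≥ 0, ∃ ρ > 0, ∀ t ∈ Ioo 0 ρ, ∀ y ∈ ball (0 : E) ρ,
      |secondDiff u ((ℝ ∙ e)ᗮ.reflection (t • e)) y - secondDiff u (t • e) y| ≤
        C * t * ‖y‖ ^ 2 := by
  obtain ⟨K, ρ, hρ, hK⟩ := exists_lipschitzOnWith_secondDiff hsm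
  refine ⟨2 * K, by positivity, ρ, hρ, fun t ht y hy => ?_⟩
  have hnorm : ‖t • e‖ = t := by rw [norm_smul, he, mul_one, Real.norm_of_nonneg ht.1.le]
  have hmem : t • e ∈ ball 0 ρ := by rw [mem_ball_zero_iff, hnorm]; exact ht.2
  rw [reflection_orthogonal_singleton_smul]
  calc |secondDiff u (-(t • e)) y - secondDiff u (t • e) y|
      ≤ K * ‖y‖ ^ 2 * ‖-(t • e) - t • e‖ :=
        (hK y hy).norm_sub_le (by rwa [mem_ball_zero_iff, norm_neg, ← mem_ball_zero_iff]) hmem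
    _ = 2 * K * t * ‖y‖ ^ 2 := by
        rw [← neg_add', norm_neg, ← two_smul ℝ, norm_smul, hnorm, Real.norm_two]
        ring

namespace OddAcross

theorem mul_antitone_sub_nonneg (hu : OddAcross (ℝ ∙ e)ᗮ u)
    (hpos : ∀ y, 0 < ⟪e, y⟫_ℝ → 0 < u y) {k : ℝ → ℝ} (hk : Antitone k) (ht : 0 ≤ t) (z : E) :
    0 ≤ u z * (k ‖z - t • e‖ - k ‖z - (ℝ ∙ e)ᗮ.reflection (t • e)‖) := by
  have hsq := norm_sub_reflection_sq_sub e t z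
  rcases le_total 0 ⟪e, z⟫_ℝ with hz | hz
  · refine mul_nonneg (hu.nonneg_of_inner_nonneg hpos hz) (sub_nonneg.2 (hk ?_))
    exact le_of_sq_le_sq (by nlinarith) (norm_nonneg _)
  · refine mul_nonneg_of_nonpos_of_nonpos (hu.nonpos_of_inner_nonpos hpos hz)
      (sub_nonpos.2 (hk ?_))
    exact le_of_sq_le_sq (by nlinarith) (norm_nonneg _)

theorem exists_eventually_apply_smul_le_cube (hu : OddAcross (ℝ ∙ e)ᗮ u) (he : ‖e‖ = 1)
    (hsm : ContDiffAt ℝ 3 u 0) (hd : fderiv ℝ u 0 e = 0) :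
    ∃ M ≥ 0, ∀ᶠ t in 𝓝[>] (0 : ℝ), u (t • e) ≤ M * t ^ 3 := by
  obtain ⟨K, ρ, hρ, hK⟩ := exists_norm_centralDiff_sub_fderiv_le hsm
  refine ⟨K, K.2, ?_⟩
  filter_upwards [Ioo_mem_nhdsGT hρ] with t ⟨ht, htρ⟩
  have hnorm : ‖t • e‖ = t := by rw [norm_smul, he, mul_one, Real.norm_of_nonneg ht.le]
  have h := hK (t • e) (by rwa [mem_ball_zero_iff, hnorm])
  rw [zero_add, zero_sub, hu.apply_neg_smul, map_smul, hd, smul_zero, smul_zero, sub_zero,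
    sub_neg_eq_add, hnorm] at h
  have hM : 0 ≤ K * t ^ 3 := by positivity
  linarith [(le_abs_self _).trans h]

end OddAcross

variable [FiniteDimensional ℝ E] [MeasurableSpace E] [BorelSpace E]

theorem setIntegral_ball_two_smul_pos (he : ‖e‖ = 1) (hpos : ∀ y, 0 < ⟪e, y⟫_ℝ → 0 < u y)
    (hball : IntegrableOn u (ball ((2 : ℝ) • e) 1)) : 0 < ∫ z in ball ((2 : ℝ) • e) 1, u z := by
  have hu : ∀ z ∈ ball ((2 : ℝ) • e) 1, 0 < u z := fun z hz =>
    hpos z (one_pos.trans_le (one_le_inner_of_mem_ball he hz))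
  have hsupp : Function.support u ∩ ball ((2 : ℝ) • e) 1 = ball ((2 : ℝ) • e) 1 :=
    inter_eq_right.2 fun z hz => (hu z hz).ne'
  rw [setIntegral_pos_iff_support_of_nonneg_ae
    ((ae_restrict_iff' measurableSet_ball).2 (ae_of_all _ fun z hz => (hu z hz).le)) hball,
    hsupp]
  exact measure_ball_pos volume _ one_pos

namespace OddAcross

theorem mul_setIntegral_le_integral_mul_truncRpow (hu : OddAcross (ℝ ∙ e)ᗮ u)
    (hpos : ∀ y, 0 < ⟪e, y⟫_ℝ → 0 < u y) (he : ‖e‖ = 1) (hp : 0 ≤ p) (hr : 0 < r)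
    (hr' : r ≤ 1 / 2) (ht : 0 ≤ t) (ht' : t ≤ 1 / 2) (hball : IntegrableOn u (ball ((2 : ℝ) • e) 1))
    (hint : Integrable fun z => u z * truncRpow p r ‖z - t • e‖) :
    p * 4 ^ (-p - 1) / 4 * (∫ z in ball ((2 : ℝ) • e) 1, u z) * t ≤
      ∫ z, u z * truncRpow p r ‖z - t • e‖ := by
  set D : E → ℝ := fun z => u z *
    (truncRpow p r ‖z - t • e‖ - truncRpow p r ‖z - (ℝ ∙ e)ᗮ.reflection (t • e)‖) with hD
  have hDint : Integrable D := by
    simp only [hD, mul_sub]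
    exact hint.sub (hu.integrable_mul_norm_sub_reflection hint)
  have hle : ∫ z in ball ((2 : ℝ) • e) 1, u z * (p * 4 ^ (-p - 1) * (t / 2)) ≤ ∫ z, D z :=
    (setIntegral_mono_on (hball.mul_const _) hDint.integrableOn measurableSet_ball fun z hz =>
      mul_le_mul_of_nonneg_left (mul_le_truncRpow_norm_sub he hp hr' ht ht' hz)
        (hpos z (one_pos.trans_le (one_le_inner_of_mem_ball he hz))).le).trans
    (setIntegral_le_integral hDint (ae_of_all _ fun z =>
      hu.mul_antitone_sub_nonneg hpos (antitone_truncRpow hp hr) ht z))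
  rw [integral_mul_const, ← hu.two_mul_integral_mul_norm_sub hint] at hle
  linarith

theorem integral_sub_mul_truncRpow_le (hu : OddAcross (ℝ ∙ e)ᗮ u)
    (hpos : ∀ y, 0 < ⟪e, y⟫_ℝ → 0 < u y) (he : ‖e‖ = 1) (hp : (Module.finrank ℝ E : ℝ) < p)
    (hr : 0 < r) (hr' : r ≤ 1 / 2) (ht : 0 ≤ t) (ht' : t ≤ 1 / 2)
    (hball : IntegrableOn u (ball ((2 : ℝ) • e) 1))
    (hint : Integrable fun y => (u (t • e) - u (t • e + y)) * truncRpow p r ‖y‖) :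
    ∫ y, (u (t • e) - u (t • e + y)) * truncRpow p r ‖y‖ ≤
      u (t • e) * (∫ y : E, truncRpow p r ‖y‖) -
        p * 4 ^ (-p - 1) / 4 * (∫ z in ball ((2 : ℝ) • e) 1, u z) * t := by
  have hkernel := (integrable_truncRpow_norm hp hr).const_mul (u (t • e))
  have hshift : Integrable fun y => u (t • e + y) * truncRpow p r ‖y‖ :=
    (hkernel.sub hint).congr (ae_of_all _ fun y => by simp only [Pi.sub_apply]; ring)
  have hcentred := hshift.comp_sub_right (t • e)
  have htranslate := integral_sub_right_eq_self (μ := volume)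
    (fun y => u (t • e + y) * truncRpow p r ‖y‖) (t • e)
  simp only [add_sub_cancel] at hcentred htranslate
  simp only [sub_mul]
  rw [integral_sub hkernel hshift, integral_const_mul, ← htranslate]
  exact sub_le_sub_left (hu.mul_setIntegral_le_integral_mul_truncRpow hpos he
    ((Nat.cast_nonneg _).trans hp.le) hr hr' ht ht' hball hcentred) _

variable [Nontrivial E]

theorem principalValue_le {C ℓ : ℝ} (hu : OddAcross (ℝ ∙ e)ᗮ u)
    (hpos : ∀ y, 0 < ⟪e, y⟫_ℝ → 0 < u y) (he : ‖e‖ = 1) (hloc : LocallyIntegrable u)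
    (hp : (Module.finrank ℝ E : ℝ) < p) (hp' : p < Module.finrank ℝ E + 2) (hr : 0 < r)
    (hr' : r ≤ 1 / 2) (ht : 0 ≤ t) (ht' : t ≤ 1 / 2) (hC : 0 ≤ C)
    (hdiff : ∀ y ∈ ball (0 : E) r,
      |secondDiff u ((ℝ ∙ e)ᗮ.reflection (t • e)) y - secondDiff u (t • e) y| ≤ C * t * ‖y‖ ^ 2)
    (h : HasPrincipalValueAt p u (t • e) ℓ) :
    ℓ ≤ C / 4 * (∫ y in ball (0 : E) r, ‖y‖ ^ (2 - p)) * t +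
      u (t • e) * (∫ y : E, truncRpow p r ‖y‖) -
        p * 4 ^ (-p - 1) / 4 * (∫ z in ball ((2 : ℝ) • e) 1, u z) * t := by
  have hball : IntegrableOn u (ball ((2 : ℝ) • e) 1) :=
    (hloc.integrableOn_isCompact (isCompact_closedBall _ _)).mono_set ball_subset_closedBall
  have hnear := h.le_of_oddAcross hu hloc ((Nat.cast_nonneg _).trans hp.le) hr
    (mul_nonneg hC ht) hdiff (integrableOn_ball_norm_rpow (by linarith) r)
  have hfar := hu.integral_sub_mul_truncRpow_le hpos he hp hr hr' ht ht' hball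
    (h.integrable_mul_truncRpow hloc hr)
  linarith

theorem exists_eventually_principalValue_le (hu : OddAcross (ℝ ∙ e)ᗮ u)
    (hpos : ∀ y, 0 < ⟪e, y⟫_ℝ → 0 < u y) (he : ‖e‖ = 1) (hsm : ContDiffAt ℝ 3 u 0)
    (hd : fderiv ℝ u 0 e = 0) (hloc : LocallyIntegrable u)
    (hp : (Module.finrank ℝ E : ℝ) < p) (hp' : p < Module.finrank ℝ E + 2) :
    ∃ k > 0, ∀ᶠ t in 𝓝[>] (0 : ℝ), ∀ ℓ, HasPrincipalValueAt p u (t • e) ℓ → ℓ ≤ -(k * t) := by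
  obtain ⟨C, hC, ρ, hρ, hdiff⟩ := exists_abs_secondDiff_reflection_sub_le he hsm
  obtain ⟨M, -, hcube⟩ := hu.exists_eventually_apply_smul_le_cube he hsm hd
  have hp0 : 0 < p := (Nat.cast_nonneg _).trans_lt hp
  have hmass := setIntegral_ball_two_smul_pos he hpos
    ((hloc.integrableOn_isCompact (isCompact_closedBall _ _)).mono_set ball_subset_closedBall)
  set m := p * 4 ^ (-p - 1) / 4 * ∫ z in ball ((2 : ℝ) • e) 1, u z with hm
  have hm0 : 0 < m := by positivity
  have hnear : Tendsto (fun r => C / 4 * ∫ y in ball (0 : E) r, ‖y‖ ^ (2 - p)) (𝓝[>] 0) (𝓝 0) := by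
    simpa only [mul_zero] using
      (tendsto_integral_ball_norm_rpow (by linarith : -(Module.finrank ℝ E : ℝ) < 2 - p)).const_mul
        (C / 4)
  obtain ⟨r, hJ, hr, hrmin⟩ := ((hnear.eventually_lt_const (by positivity : (0 : ℝ) < m / 4)).and
    (Ioo_mem_nhdsGT (lt_min hρ one_half_pos))).exists
  have hquad : Tendsto (fun t : ℝ => M * t ^ 2 * ∫ y : E, truncRpow p r ‖y‖) (𝓝[>] 0) (𝓝 0) :=
    tendsto_nhdsWithin_of_tendsto_nhds (Continuous.tendsto' (by fun_prop) _ _ (by simp))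
  refine ⟨m / 2, half_pos hm0, ?_⟩
  filter_upwards [hcube, hquad.eventually_lt_const (by positivity : (0 : ℝ) < m / 4),
    Ioo_mem_nhdsGT (lt_min hρ one_half_pos)] with t hut hS ⟨ht, htmin⟩ ℓ h
  have hle := hu.principalValue_le hpos he hloc hp hp' hr (hrmin.le.trans (min_le_right _ _)) ht.le
    (htmin.le.trans (min_le_right _ _)) hC
    (fun y hy => hdiff t ⟨ht, htmin.trans_le (min_le_left _ _)⟩ y
      (ball_subset_ball (hrmin.le.trans (min_le_left _ _)) hy)) h
  have hboundary : u (t • e) * (∫ y : E, truncRpow p r ‖y‖) ≤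
      M * t ^ 2 * (∫ y : E, truncRpow p r ‖y‖) * t :=
    (mul_le_mul_of_nonneg_right hut
      (integral_nonneg fun y => truncRpow_nonneg hr.le _)).trans_eq (by ring)
  rw [← hm] at hle
  nlinarith

end OddAcross

end BoundaryAsymptotics

section HopfLemma

variable {E : Type*} [NormedAddCommGroup E] [InnerProductSpace ℝ E] [FiniteDimensional ℝ E]
  [MeasurableSpace E] [BorelSpace E] {p : ℝ} {u : E → ℝ} {e : E} {c : ℝ → ℝ}

theorem OddAcross.fderiv_pos_of_hasPrincipalValueAt (hu : OddAcross (ℝ ∙ e)ᗮ u)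
    (hpos : ∀ y, 0 < ⟪e, y⟫_ℝ → 0 < u y) (he : ‖e‖ = 1) (hsm : ContDiffAt ℝ 3 u 0)
    (hp : (Module.finrank ℝ E : ℝ) < p) (hp' : p < Module.finrank ℝ E + 2)
    (hc : ∀ ε > 0, ∀ᶠ t in 𝓝[>] (0 : ℝ), c t ≤ ε / t ^ 2)
    (hsuper : ∀ᶠ t in 𝓝[>] (0 : ℝ), ∃ ℓ, HasPrincipalValueAt p u (t • e) ℓ ∧
      0 ≤ ℓ + c t * u (t • e)) :
    0 < fderiv ℝ u 0 e := by
  refine (hu.fderiv_nonneg hpos (hsm.differentiableAt (by simp))).lt_of_ne fun hd => ?_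
  have : Nontrivial E := nontrivial_of_ne e 0 (norm_ne_zero_iff.1 (he ▸ one_ne_zero))
  have hcont : ∀ᶠ x in 𝓝 (0 : E), ContinuousAt u x :=
    (hsm.eventually (by simp)).mono fun x hx => hx.continuousAt
  have hray : Tendsto (fun t : ℝ => t • e) (𝓝[>] 0) (𝓝 0) :=
    tendsto_nhdsWithin_of_tendsto_nhds (Continuous.tendsto' (by fun_prop) _ _ (zero_smul ℝ e))
  have hloc : LocallyIntegrable u := by
    obtain ⟨t, ⟨ℓ, h, -⟩, ht⟩ :=
      (hsuper.and (hray.eventually (eventually_integrableAtFilter_nhds hcont))).exists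
    exact h.locallyIntegrable ht
  obtain ⟨k, hk, hle⟩ := hu.exists_eventually_principalValue_le hpos he hsm hd.symm hloc hp hp'
  obtain ⟨M, hM, hcube⟩ := hu.exists_eventually_apply_smul_le_cube he hsm hd.symm
  obtain ⟨t, ⟨ℓ, h, hℓ⟩, hℓk, hut, hct, ht : 0 < t⟩ := (hsuper.and (hle.and (hcube.and
    ((hc (k / (M + 1)) (by positivity)).and eventually_mem_nhdsWithin)))).exists
  have hu0 : 0 < u (t • e) := hpos _ (by
    rwa [inner_smul_right, real_inner_self_eq_norm_sq, he, one_pow, mul_one])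
  have hpotential : c t * u (t • e) < k * t :=
    calc c t * u (t • e) ≤ k / (M + 1) / t ^ 2 * (M * t ^ 3) := by gcongr
      _ = k * t * (M / (M + 1)) := by field_simp
      _ < k * t := mul_lt_of_lt_one_right (mul_pos hk ht) ((div_lt_one (by positivity)).2 (by simp))
  linarith [hℓk ℓ h]

end HopfLemma

section EuclideanSpace

variable {n : ℕ} {α : ℝ}

theorem fracLaplacianConst_pos (hα0 : 0 < α) (hα2 : α < 2) : 0 < fracLaplacianConst n α := by
  have : 0 < Real.Gamma ((n + α) / 2) := Real.Gamma_pos_of_pos (by positivity)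
  have : 0 < Real.Gamma (1 - α / 2) := Real.Gamma_pos_of_pos (by linarith)
  unfold fracLaplacianConst
  positivity

theorem HasFracLaplacianAt.hasPrincipalValueAt {w : EuclideanSpace ℝ (Fin n) → ℝ}
    {x : EuclideanSpace ℝ (Fin n)} {L : ℝ} (h : HasFracLaplacianAt α w x L) (hα0 : 0 < α)
    (hα2 : α < 2) : HasPrincipalValueAt (n + α) w x (L / fracLaplacianConst n α) := by
  have hkernel (y : EuclideanSpace ℝ (Fin n)) :
      (w x - w (x + y)) / ‖x - (x + y)‖ ^ ((n : ℝ) + α) =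
        (w x - w (x + y)) * ‖y‖ ^ (-((n : ℝ) + α)) := by
    rw [sub_add_cancel_left, norm_neg, Real.rpow_neg (norm_nonneg _), div_eq_mul_inv]
  refine ⟨fun ε hε => ?_, (h.2.div_const (fracLaplacianConst n α)).congr fun ε => ?_⟩
  · simpa only [hkernel] using integrableOn_compl_ball_add_left_iff.2 (h.1 ε hε)
  · rw [mul_div_cancel_left₀ _ (fracLaplacianConst_pos hα0 hα2).ne',
      ← (measurePreserving_add_left volume x).setIntegral_preimage_emb
        (measurableEmbedding_addLeft x), preimage_compl, preimage_add_ball, sub_self]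
    simp only [hkernel]

variable [NeZero n] {lam : ℝ} {x y z : EuclideanSpace ℝ (Fin n)}

theorem mem_frontier_halfSpace_iff : x ∈ frontier (halfSpace n lam) ↔ x 0 = lam := by
  have h := (PiLp.isOpenMap_apply 2 (fun _ : Fin n => ℝ) 0).preimage_frontier_eq_frontier_preimage
    (by fun_prop) (Ioi lam)
  rw [frontier_Ioi] at h
  exact (Set.ext_iff.1 h x).symm

theorem planeReflection_planeReflection : planeReflection lam (planeReflection lam x) = x := by
  ext i
  by_cases hi : i = 0 <;> simp [planeReflection, hi]

theorem planeReflection_add (hx : x 0 = lam) :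
    planeReflection lam (x + y) =
      x + (ℝ ∙ (EuclideanSpace.single 0 1 : EuclideanSpace ℝ (Fin n)))ᗮ.reflection y := by
  rw [Submodule.reflection_orthogonal_apply, Submodule.reflection_singleton_apply]
  ext i
  by_cases hi : i = 0
  · subst hi
    simp [planeReflection, hx, EuclideanSpace.inner_single_left]
    ring
  · simp [planeReflection, hi]

theorem planeReflection_eq_neg {w : EuclideanSpace ℝ (Fin n) → ℝ}
    (hcont : ∀ x ∈ frontier (halfSpace n lam), ContinuousAt w x)
    (hanti : ∀ x ∈ halfSpace n lam, w (planeReflection lam x) = -w x)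
    (x : EuclideanSpace ℝ (Fin n)) : w (planeReflection lam x) = -w x := by
  rcases lt_trichotomy (x 0) lam with h | h | h
  · have hmem : planeReflection lam x ∈ halfSpace n lam := by
      change lam < _
      simp only [planeReflection, Function.update_self]
      linarith
    rw [← neg_eq_iff_eq_neg, ← hanti _ hmem, planeReflection_planeReflection]
  · have hmem : x ∈ frontier (halfSpace n lam) := mem_frontier_halfSpace_iff.2 h
    have hfix : planeReflection lam x = x := by
      simpa only [add_zero, map_zero] using planeReflection_add (y := 0) h
    have hreflect : Continuous (planeReflection (n := n) lam) := by
      unfold planeReflection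
      fun_prop
    have hlim := (hcont x hmem).tendsto
    have hlim' := hlim.comp (hfix ▸ hreflect.tendsto x : Tendsto _ (𝓝 x) (𝓝 x))
    have : (𝓝[halfSpace n lam] x).NeBot :=
      mem_closure_iff_nhdsWithin_neBot.1 (frontier_subset_closure hmem)
    rw [hfix]
    exact tendsto_nhds_unique_of_eventuallyEq (hlim'.mono_left nhdsWithin_le_nhds)
      (hlim.neg.mono_left nhdsWithin_le_nhds) (eventually_mem_nhdsWithin.mono hanti)
  · exact hanti x h

theorem sub_le_infDist_frontier_halfSpace (hx : x ∈ frontier (halfSpace n lam)) :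
    z 0 - lam ≤ infDist z (frontier (halfSpace n lam)) := by
  refine (le_infDist ⟨x, hx⟩).2 fun y hy => ?_
  rw [← mem_frontier_halfSpace_iff.1 hy, dist_eq_norm]
  exact (le_abs_self _).trans (PiLp.norm_apply_le (z - y) 0)

theorem tendsto_add_smul_nhdsWithin_halfSpace (hx : x 0 = lam) :
    Tendsto (fun t : ℝ => x + t • EuclideanSpace.single 0 1) (𝓝[>] 0) (𝓝[halfSpace n lam] x) := by
  refine tendsto_nhdsWithin_iff.2
    ⟨tendsto_nhdsWithin_of_tendsto_nhds (Continuous.tendsto' (by fun_prop) _ _ (by simp)),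
      eventually_mem_nhdsWithin.mono fun t (ht : 0 < t) => ?_⟩
  simpa [halfSpace, hx] using ht

end EuclideanSpace

theorem mainTheorem1_general (n : ℕ) [NeZero n] (α : ℝ) (hα0 : 0 < α) (hα2 : α < 2) (lam : ℝ)
    (w c : EuclideanSpace ℝ (Fin n) → ℝ)
    (hw_anti : ∀ x, w (planeReflection lam x) = -w x)
    (hw_pos : ∀ x ∈ halfSpace n lam, 0 < w x)
    (x₀ : EuclideanSpace ℝ (Fin n)) (hx₀ : x₀ ∈ frontier (halfSpace n lam))
    (hw_smooth : ContDiffAt ℝ 3 w x₀)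
    (hc : ∀ ε > 0, ∀ᶠ x in 𝓝[halfSpace n lam] x₀,
      c x ≤ ε / infDist x (frontier (halfSpace n lam)) ^ 2)
    (hw_super : ∀ᶠ x in 𝓝[halfSpace n lam] x₀,
      ∃ L, HasFracLaplacianAt α w x L ∧ 0 ≤ L + c x * w x) :
    lineDeriv ℝ w x₀ (outwardNormal n) < 0 := by
  have hx₀' : x₀ 0 = lam := mem_frontier_halfSpace_iff.1 hx₀
  have hA := fracLaplacianConst_pos (n := n) hα0 hα2
  set e : EuclideanSpace ℝ (Fin n) := EuclideanSpace.single 0 1 with he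
  have hray : Tendsto (fun t : ℝ => x₀ + t • e) (𝓝[>] 0) (𝓝[halfSpace n lam] x₀) :=
    tendsto_add_smul_nhdsWithin_halfSpace hx₀'
  have hodd : OddAcross (ℝ ∙ e)ᗮ fun y => w (x₀ + y) := fun y => by
    rw [← hw_anti, planeReflection_add hx₀']
  have he1 : ‖e‖ = 1 := by simp [he]
  have hpos (y) (hy : 0 < ⟪e, y⟫_ℝ) : 0 < w (x₀ + y) := hw_pos _ (by
    simpa [halfSpace, hx₀', he, EuclideanSpace.inner_single_left] using hy)
  have hsm : ContDiffAt ℝ 3 (fun y => w (x₀ + y)) 0 :=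
    ContDiffAt.comp 0 (by rwa [add_zero]) (by fun_prop)
  have hderiv : 0 < fderiv ℝ (fun y => w (x₀ + y)) 0 e := by
    refine hodd.fderiv_pos_of_hasPrincipalValueAt hpos he1 hsm (p := n + α)
      (c := fun t => c (x₀ + t • e) / fracLaplacianConst n α)
      (by simpa using hα0) (by simpa using hα2) (fun ε hε => ?_)
      ((hray.eventually hw_super).mono fun t ⟨L, hL, hnonneg⟩ =>
        ⟨L / fracLaplacianConst n α, ?_, ?_⟩)
    · filter_upwards [hray.eventually (hc (ε * fracLaplacianConst n α) (by positivity)),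
        eventually_mem_nhdsWithin] with t hct (ht : 0 < t)
      have hdist := sub_le_infDist_frontier_halfSpace (z := x₀ + t • e) hx₀
      rw [show (x₀ + t • e) 0 - lam = t by simp [hx₀', he]] at hdist
      rw [div_le_iff₀ hA, div_mul_eq_mul_div]
      exact hct.trans (by gcongr)
    · simpa only [HasPrincipalValueAt, add_assoc] using hL.hasPrincipalValueAt hα0 hα2
    · rw [div_mul_eq_mul_div, ← add_div]
      exact div_nonneg hnonneg hA.le
  rw [fderiv_comp_add_left, add_zero] at hderiv
  rw [(hw_smooth.differentiableAt (by simp)).lineDeriv_eq_fderiv, outwardNormal, map_neg]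
  exact neg_neg_of_pos hderiv

theorem mainTheorem1 (n : ℕ) [NeZero n] (α : ℝ) (hα0 : 0 < α) (hα2 : α < 2) (lam : ℝ)
    (w c : EuclideanSpace ℝ (Fin n) → ℝ)
    (hw_smooth : ∀ x ∈ closure (halfSpace n lam), ContDiffAt ℝ 3 w x)
    (hc : ∀ x₀ ∈ frontier (halfSpace n lam), ∀ ε : ℝ, 0 < ε →
      ∀ᶠ x in 𝓝[halfSpace n lam] x₀,
        c x ≤ ε / Metric.infDist x (frontier (halfSpace n lam)) ^ 2)
    (hw_eq : ∀ x ∈ halfSpace n lam,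
      ∃ L : ℝ, HasFracLaplacianAt α w x L ∧ L + c x * w x = 0)
    (hw_pos : ∀ x ∈ halfSpace n lam, 0 < w x)
    (hw_anti : ∀ x ∈ halfSpace n lam, w (planeReflection lam x) = -w x) :
    ∀ x ∈ frontier (halfSpace n lam), lineDeriv ℝ w x (outwardNormal n) < 0 := fun x hx =>
  have hsm : ∀ z ∈ frontier (halfSpace n lam), ContDiffAt ℝ 3 w z := fun z hz =>
    hw_smooth z (frontier_subset_closure hz)
  mainTheorem1_general n α hα0 hα2 lam w c
    (planeReflection_eq_neg (fun z hz => (hsm z hz).continuousAt) hw_anti) hw_pos x hx (hsm x hx)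
    (hc x hx) (eventually_mem_nhdsWithin.mono fun z hz =>
      (hw_eq z hz).imp fun _ h => ⟨h.1, h.2.ge⟩)
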